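/- Let $T=\mathrm{co}(V)\subset\mathbb{R}^3$ be a (nondegenerate) tetrahedron with vertex set $V=\{v_1,v_2,v_3,v_4\}$ and circumradius $r(V)$. A pair $(R^L,O^L)$, with $R^L>0$ and $O^L\in\mathbb{R}^3$, is called a four-crossing radius and a four-crossing point of $T$ if there are four distinct spheres $S_1,\dots,S_4$ of radius $R^L$ such that $v_i\in S_j$ whenever $i\ne j$, $S_1\cap S_2\cap S_3\cap S_4=\{O^L\}$, and $O^L$ does not lie on the circumsphere of $T$. For $\rho>0$ let $\mathrm{co}_\rho(V)$, the $\rho$-hulloid of $V$, be the intersection of the complements of all open balls of radius $\rho$ that do not meet $V$, and let $$r_L(V)=\inf\{\rho>r(V):\ \mathrm{int}(\mathrm{co}_\rho(V))\neq\emptyset\}.$$ Let $(R^L,O^L)$ be a four-crossing radius and a four-crossing point of $T$ with $O^L\in\mathrm{int}(T)$. Then $R^L$ and $O^L$ are uniquely determined: every four-crossing radius and point $(R',O')$ of $T$ with $O'\in\mathrm{int}(T)$ satisfies $R'=R^L$ and $O'=O^L$. More precisely, $R^L=r_L(V)>r(V)$, and $O^L=O^*$, where $O^*$ is the unique point outside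 $V$ with $\mathrm{co}_{r_L(V)}(V)=V\cup\{O^*\}$. -/

import Mathlib

/-- Euclidean three-dimensional space. -/
abbrev E3 : Type := EuclideanSpace ℝ (Fin 3)

/-- A tetrahedron in space: four affinely independent vertices `T.points 0, …, T.points 3`. -/
abbrev Tetrahedron : Type := Affine.Simplex ℝ E3 3

/-- The vertex set `V` of a tetrahedron. -/
def Tetrahedron.vertices (T : Tetrahedron) : Set E3 := Set.range T.points

/-- The tetrahedron as a solid body, `co(V)`. -/
def Tetrahedron.solid (T : Tetrahedron) : Set E3 := convexHull ℝ T.vertices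

/-- The `ρ`-hulloid of `E`: the intersection of the complements of all open balls of
radius `ρ` that do not meet `E` (the whole space if there is no such ball). -/
def hulloid (ρ : ℝ) (E : Set E3) : Set E3 :=
  ⋂ (z : E3) (_ : Metric.ball z ρ ∩ E = ∅), (Metric.ball z ρ)ᶜ

/-- The critical radius `r_L(V)`: the infimum of the `ρ > r(V)`, with `r(V)` the circumradius,
for which the `ρ`-hulloid of the vertex set is full, that is, has nonempty interior. -/
noncomputable def Tetrahedron.rL (T : Tetrahedron) : ℝ :=
  sInf {ρ : ℝ | T.circumradius < ρ ∧ (interior (hulloid ρ T.vertices)).Nonempty}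

/-- `R` is a four-crossing radius of `T` and `O` a corresponding four-crossing point. -/
def Tetrahedron.IsFourCrossing (T : Tetrahedron) (R : ℝ) (O : E3) : Prop :=
  0 < R ∧
  ∃ S : Fin 4 → EuclideanGeometry.Sphere E3,
    Function.Injective S ∧
    (∀ j, (S j).radius = R) ∧
    (∀ j i, i ≠ j → T.points i ∈ S j) ∧
    (⋂ j, {x : E3 | x ∈ S j}) = {O} ∧
    O ∉ T.circumsphere

/-! Take `O` as origin, with barycentric weights `w i > 0`, and let `c j` be the centres. The main
point (`CrossingData.eq_of_avoids`) is that a ball of radius `ρ ≥ R` avoiding `V` cannot contain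
`O`, even on its boundary unless `ρ = R`. Its centre `z` is an affine combination of the `c j` with
weights `ν j ≥ 0`, and `P = ρ² - ‖z‖²` satisfies `2ρ² + P/4 ≤ 2R²`. Hence `O` lies in the
`R`-hulloid and is interior to the `ρ`-hulloid for `ρ > R`. Conversely, the four crossing balls
avoid `V` and cover the rest of `T`, so the `R`-hulloid is `V ∪ {O}`. Hulloids grow with the radius,
so below `R` they are finite at most; thus `r_L(V) = R`, and uniqueness follows. -/

open scoped InnerProductSpace

/-- Tangent line of `1/b` at `b = 1/3`: `1/b ≥ 6 - 9b`, weighted by `1 - ν i ∈ [0, 1]`. -/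
lemma sum_one_sub_div_ge {b ν : Fin 4 → ℝ} (hb : ∀ i, 0 < b i) (hb1 : ∑ i, b i = 1)
    (hν : ∀ i, 0 ≤ ν i) (hν1 : ∑ i, ν i = 1) : 9 ≤ ∑ i, (1 - ν i) / b i := by
  have hle : ∀ i, ν i ≤ 1 := fun i => by
    rw [← hν1]; exact Finset.single_le_sum (fun j _ => hν j) (Finset.mem_univ i)
  have key : ∀ i, 6 * (1 - ν i) - 9 * b i ≤ (1 - ν i) / b i := fun i => by
    rw [le_div_iff₀ (hb i)]
    nlinarith [mul_nonneg (sub_nonneg.2 (hle i)) (sq_nonneg (3 * b i - 1)),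
      mul_nonneg (hν i) (sq_nonneg (b i))]
  calc (9 : ℝ) = ∑ i, (6 * (1 - ν i) - 9 * b i) := by
        simp only [Finset.sum_sub_distrib, ← Finset.mul_sum, hb1, hν1]
        simp; norm_num
    _ ≤ _ := Finset.sum_le_sum fun i _ => key i

/-! ### Four equal spheres through a common point -/

section CrossingSpheres

variable {E : Type*} [NormedAddCommGroup E] [InnerProductSpace ℝ E]

/-- A point of the affine span of points on a sphere about the origin: its squared norm. -/
lemma norm_sq_sum_smul_of_norm_eq {ι : Type*} [Fintype ι] {c : ι → E} {R : ℝ}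
    (hc : ∀ j, ‖c j‖ = R) {ν : ι → ℝ} (hν : ∑ j, ν j = 1) :
    2 * ‖∑ j, ν j • c j‖ ^ 2 = 2 * R ^ 2 - ∑ j, ∑ k, ν j * ν k * ‖c j - c k‖ ^ 2 := by
  have h1 : ∀ j k, ν j * ν k * ‖c j - c k‖ ^ 2
      = 2 * R ^ 2 * (ν j * ν k) - 2 * (ν j * (ν k * ⟪c k, c j⟫_ℝ)) := fun j k => by
    rw [norm_sub_sq_real, hc, hc, real_inner_comm]; ring
  have h2 : ‖∑ j, ν j • c j‖ ^ 2 = ∑ j, ∑ k, ν j * (ν k * ⟪c k, c j⟫_ℝ) := by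
    rw [← real_inner_self_eq_norm_sq]
    simp only [inner_sum, sum_inner, real_inner_smul_left, real_inner_smul_right]
  simp only [h1, Finset.sum_sub_distrib, ← Finset.mul_sum, hν, h2, mul_one]
  ring

/-- `O` is taken as origin, `v` are the vertices, `w` the barycentric coordinates of the origin and
`c` the centres of four spheres of radius `R` through the origin, each through three vertices. -/
structure CrossingData (v c : Fin 4 → E) (w : Fin 4 → ℝ) (R : ℝ) : Prop where
  weight_pos : ∀ i, 0 < w i
  weight_sum : ∑ i, w i = 1
  weight_smul : ∑ i, w i • v i = 0
  vertex_ne : ∀ i, v i ≠ 0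
  spanning : ∀ y : E, (∀ i, ⟪v i, y⟫_ℝ = 0) → y = 0
  norm_center : ∀ j, ‖c j‖ = R
  norm_sub : ∀ i j, i ≠ j → ‖v i - c j‖ = R

namespace CrossingData

variable {v c : Fin 4 → E} {w : Fin 4 → ℝ} {R : ℝ}

/-- The weighted mean of the halved squared norms of the vertices. -/
noncomputable def mean (v : Fin 4 → E) (w : Fin 4 → ℝ) : ℝ := ∑ i, w i * (‖v i‖ ^ 2 / 2)

lemma norm_sq_pos (h : CrossingData v c w R) (i : Fin 4) : 0 < ‖v i‖ ^ 2 / 2 := by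
  have := norm_pos_iff.2 (h.vertex_ne i)
  positivity

lemma mean_pos (h : CrossingData v c w R) : 0 < mean v w :=
  Finset.sum_pos (fun i _ => mul_pos (h.weight_pos i) (h.norm_sq_pos i)) Finset.univ_nonempty

lemma inner_of_ne (h : CrossingData v c w R) {i j : Fin 4} (hij : i ≠ j) :
    ⟪v i, c j⟫_ℝ = ‖v i‖ ^ 2 / 2 := by
  have h1 := norm_sub_sq_real (v i) (c j)
  rw [h.norm_sub i j hij, h.norm_center j] at h1
  linarith

/-- Pairing `∑ w i • v i = 0` with `c j` determines the one inner product not given by the spheres.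
-/
lemma inner_self (h : CrossingData v c w R) (j : Fin 4) :
    ⟪v j, c j⟫_ℝ = ‖v j‖ ^ 2 / 2 - mean v w / w j := by
  have h0 : ∑ i, w i * ⟪v i, c j⟫_ℝ = 0 := by
    have := congrArg (fun y => ⟪y, c j⟫_ℝ) h.weight_smul
    simpa [sum_inner, real_inner_smul_left] using this
  have h1 : ∑ i, w i * (‖v i‖ ^ 2 / 2 - ⟪v i, c j⟫_ℝ)
      = w j * (‖v j‖ ^ 2 / 2 - ⟪v j, c j⟫_ℝ) :=
    Finset.sum_eq_single j (fun i _ hi => by rw [h.inner_of_ne hi]; ring) (by simp)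
  simp only [mul_sub, Finset.sum_sub_distrib, h0] at h1
  have hw := (h.weight_pos j).ne'
  rw [eq_sub_iff_add_eq, ← eq_sub_iff_add_eq', div_eq_iff hw, mean]
  linarith

lemma inner_eq (h : CrossingData v c w R) (i j : Fin 4) :
    ⟪v i, c j⟫_ℝ = ‖v i‖ ^ 2 / 2 - if j = i then mean v w / w i else 0 := by
  split_ifs with hij
  · rw [hij, h.inner_self]
  · rw [h.inner_of_ne (Ne.symm hij), sub_zero]

/-- For `i = j` the squared distance is `R² + 2 * mean v w / w j`, so all four crossing balls avoid
`V`. -/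
lemma le_norm_sub_vertex (h : CrossingData v c w R) (i j : Fin 4) : R ≤ ‖v i - c j‖ := by
  by_cases hij : i = j
  · subst hij
    refine le_of_sq_le_sq ?_ (norm_nonneg _)
    have := div_pos h.mean_pos (h.weight_pos i)
    rw [norm_sub_sq_real, h.inner_self, h.norm_center]
    linarith
  · exact (h.norm_sub i j hij).ge

/-- Cauchy–Schwarz against `v j`; the left side is `g j / (2 * b j)` in the notation of
`eq_of_avoids`. -/
lemma center_dist_sq_ge (h : CrossingData v c w R) {j k : Fin 4} (hjk : j ≠ k) :
    mean v w / w j / (2 * (w j * (‖v j‖ ^ 2 / 2) / mean v w)) ≤ ‖c j - c k‖ ^ 2 := by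
  have hB := h.mean_pos
  have hw := h.weight_pos j
  have hn := h.norm_sq_pos j
  have h1 : ⟪v j, c j - c k⟫_ℝ = -(mean v w / w j) := by
    rw [inner_sub_right, h.inner_self, h.inner_of_ne hjk]; ring
  have h2 := real_inner_mul_inner_self_le (v j) (c j - c k)
  rw [h1, real_inner_self_eq_norm_sq, real_inner_self_eq_norm_sq] at h2
  have h3 : mean v w / w j / (2 * (w j * (‖v j‖ ^ 2 / 2) / mean v w))
      = (mean v w / w j) ^ 2 / ‖v j‖ ^ 2 := by
    field_simp
  rw [h3, div_le_iff₀ (by linarith)]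
  linarith

/-- A ball of radius at least `R` about `z` that avoids the vertices contains the origin neither in
its interior nor, unless its radius is `R`, on its boundary. -/
theorem eq_of_avoids (h : CrossingData v c w R) {ρ : ℝ} {z : E} (hR : 0 < R) (hρ : R ≤ ρ)
    (hz : ‖z‖ ≤ ρ) (hv : ∀ i, ρ ≤ ‖v i - z‖) : ρ = R ∧ ‖z‖ = ρ := by
  have hB := h.mean_pos
  set g : Fin 4 → ℝ := fun i => mean v w / w i with hg
  have hgpos : ∀ i, 0 < g i := fun i => div_pos hB (h.weight_pos i)
  set b : Fin 4 → ℝ := fun i => w i * (‖v i‖ ^ 2 / 2) / mean v w with hb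
  have hbpos : ∀ i, 0 < b i := fun i => div_pos (mul_pos (h.weight_pos i) (h.norm_sq_pos i)) hB
  have hb1 : ∑ i, b i = 1 := by
    rw [hb, ← Finset.sum_div]; exact div_self hB.ne'
  -- These are the barycentric coordinates of `z` with respect to the centres, by `inner_eq`.
  set ν : Fin 4 → ℝ := fun i => (‖v i‖ ^ 2 / 2 - ⟪v i, z⟫_ℝ) / g i with hνdef
  have hνg : ∀ i, ν i * g i = ‖v i‖ ^ 2 / 2 - ⟪v i, z⟫_ℝ := fun i =>
    div_mul_cancel₀ _ (hgpos i).ne'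
  have hν1 : ∑ i, ν i = 1 := by
    have h0 : ∑ i, w i * ⟪v i, z⟫_ℝ = 0 := by
      have := congrArg (fun y => ⟪y, z⟫_ℝ) h.weight_smul
      simpa [sum_inner, real_inner_smul_left] using this
    have h1 : ∀ i, ν i = (w i * (‖v i‖ ^ 2 / 2) - w i * ⟪v i, z⟫_ℝ) / mean v w := fun i => by
      have := (h.weight_pos i).ne'
      simp only [hνdef, hg]; field_simp
    simp only [h1, ← Finset.sum_div, Finset.sum_sub_distrib, h0, sub_zero]
    exact div_self hB.ne'
  have hzc : z = ∑ j, ν j • c j := by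
    rw [← sub_eq_zero]
    refine h.spanning _ fun i => ?_
    rw [inner_sub_right, inner_sum]
    simp only [real_inner_smul_right, h.inner_eq, mul_sub, Finset.sum_sub_distrib,
      ← Finset.sum_mul, hν1, mul_ite, mul_zero, Finset.sum_ite_eq', Finset.mem_univ, if_true]
    have := hνg i
    simp only [hg] at this
    linarith
  have hQ := norm_sq_sum_smul_of_norm_eq h.norm_center hν1
  rw [← hzc] at hQ
  have hP : 0 ≤ ρ ^ 2 - ‖z‖ ^ 2 := sub_nonneg.2 (pow_le_pow_left₀ (norm_nonneg z) hz 2)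
  have hνP : ∀ i, ρ ^ 2 - ‖z‖ ^ 2 ≤ 2 * (ν i * g i) := fun i => by
    have h1 := pow_le_pow_left₀ (hR.le.trans hρ) (hv i) 2
    rw [norm_sub_sq_real] at h1
    rw [hνg]; linarith
  have hν0 : ∀ i, 0 ≤ ν i := fun i => by
    by_contra hneg
    have := mul_neg_of_neg_of_pos (not_le.1 hneg) (hgpos i)
    linarith [hνP i]
  have hle : ∀ i, ν i ≤ 1 := fun i => by
    rw [← hν1]; exact Finset.single_le_sum (fun j _ => hν0 j) (Finset.mem_univ i)
  -- The lower bound for `‖c j - c k‖ ^ 2` does not depend on `k`, so the row sums to a multiple of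
  -- `ν j * (1 - ν j)`; then `hνP` trades `ν j * g j` for `P / 2`.
  have hrow : ∀ j, (ρ ^ 2 - ‖z‖ ^ 2) / 4 * ((1 - ν j) / b j)
      ≤ ∑ k, ν j * ν k * ‖c j - c k‖ ^ 2 := fun j => by
    have h1 : ∑ k, ν j * ν k * (if k = j then 0 else g j / (2 * b j))
        = ν j * (1 - ν j) * (g j / (2 * b j)) := by
      have : ∀ k, ν j * ν k * (if k = j then 0 else g j / (2 * b j))
          = ν j * (g j / (2 * b j)) * ν k
            - if k = j then ν j * (g j / (2 * b j)) * ν k else 0 := fun k => by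
        split_ifs <;> ring
      simp only [this, Finset.sum_sub_distrib, ← Finset.mul_sum, hν1, Finset.sum_ite_eq',
        Finset.mem_univ, if_true]
      ring
    calc (ρ ^ 2 - ‖z‖ ^ 2) / 4 * ((1 - ν j) / b j)
        ≤ 2 * (ν j * g j) / 4 * ((1 - ν j) / b j) := by
          have := div_nonneg (sub_nonneg.2 (hle j)) (hbpos j).le
          have := hνP j
          gcongr
      _ = ν j * (1 - ν j) * (g j / (2 * b j)) := by
          have := (hbpos j).ne'
          field_simp; ring
      _ = _ := h1.symm
      _ ≤ _ := by
          refine Finset.sum_le_sum fun k _ =>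
            mul_le_mul_of_nonneg_left ?_ (mul_nonneg (hν0 j) (hν0 k))
          split_ifs with hkj
          · positivity
          · exact h.center_dist_sq_ge (Ne.symm hkj)
  have hsum := Finset.sum_le_sum fun j (_ : j ∈ Finset.univ) => hrow j
  rw [← Finset.mul_sum] at hsum
  have h9 := mul_le_mul_of_nonneg_left (sum_one_sub_div_ge hbpos hb1 hν0 hν1)
    (div_nonneg hP (by norm_num : (0 : ℝ) ≤ 4))
  have hρR := pow_le_pow_left₀ hR.le hρ 2
  -- The rows give `2‖z‖² ≤ 2R² - 9P/4`, that is `2ρ² + P/4 ≤ 2R²`. With `ρ ≥ R` this forces `P =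
  -- 0`, because `9 > 8`.
  have e1 : ρ ^ 2 = R ^ 2 := by linarith
  have e2 : ‖z‖ ^ 2 = ρ ^ 2 := by linarith
  exact ⟨(pow_left_inj₀ (hR.le.trans hρ) hR.le two_ne_zero).1 e1,
    (pow_left_inj₀ (norm_nonneg z) (hR.le.trans hρ) two_ne_zero).1 e2⟩

/-- A point equidistant from the vertices is at distance less than `R` from them. -/
theorem circumradius_lt (h : CrossingData v c w R) {r : ℝ} {q : E} (hR : 0 < R) (hr : 0 < r)
    (hq : ∀ i, ‖v i - q‖ = r) : r < R := by
  by_contra! hle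
  have hqr : ‖q‖ < r := by
    have h0 : ∑ i, w i * ⟪v i, q⟫_ℝ = 0 := by
      have := congrArg (fun y => ⟪y, q⟫_ℝ) h.weight_smul
      simpa [sum_inner, real_inner_smul_left] using this
    have h1 : ∀ i, w i * (‖v i‖ ^ 2 / 2) = w i * ⟪v i, q⟫_ℝ + w i * ((r ^ 2 - ‖q‖ ^ 2) / 2) :=
      fun i => by
        have := norm_sub_sq_real (v i) q
        rw [hq i] at this
        rw [this]; ring
    have h2 : mean v w = (r ^ 2 - ‖q‖ ^ 2) / 2 := by
      simp only [mean, h1, Finset.sum_add_distrib, h0, ← Finset.sum_mul, h.weight_sum]; ring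
    have := h.mean_pos
    exact lt_of_pow_lt_pow_left₀ 2 hr.le (by linarith)
  -- Shrinking the circumball towards the origin, which is inside it, to radius `R` gives a ball
  -- avoiding the vertices with the origin in its interior.
  have hs0 : 0 < R / r := div_pos hR hr
  have hs1 : R / r ≤ 1 := (div_le_one hr).2 hle
  have hsr : R / r * r = R := div_mul_cancel₀ _ hr.ne'
  have hz : ‖(R / r) • q‖ < R := by
    rw [norm_smul, Real.norm_of_nonneg hs0.le]
    calc R / r * ‖q‖ < R / r * r := by gcongr
      _ = R := hsr
  refine hz.ne (h.eq_of_avoids hR le_rfl hz.le fun i => ?_).2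
  have h1 : ‖v i - q‖ ≤ ‖v i - (R / r) • q‖ + ‖(R / r) • q - q‖ :=
    norm_sub_le_norm_sub_add_norm_sub ..
  have h2 : ‖(R / r) • q - q‖ = (1 - R / r) * ‖q‖ := by
    have : (R / r) • q - q = (R / r - 1) • q := by rw [sub_smul, one_smul]
    rw [this, norm_smul, Real.norm_of_nonpos (by linarith)]; ring
  have h3 : (1 - R / r) * ‖q‖ ≤ (1 - R / r) * r :=
    mul_le_mul_of_nonneg_left hqr.le (by linarith)
  rw [hq i, h2] at h1
  nlinarith

end CrossingData

end CrossingSpheres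

/-! ### General properties of hulloids -/

lemma mem_hulloid_iff {ρ : ℝ} {A : Set E3} {x : E3} :
    x ∈ hulloid ρ A ↔ ∀ z, (∀ a ∈ A, ρ ≤ dist a z) → ρ ≤ dist x z := by
  simp only [hulloid, Set.mem_iInter, Set.mem_compl_iff, Metric.mem_ball, not_lt,
    Set.eq_empty_iff_forall_notMem, Set.mem_inter_iff, not_and']

lemma subset_hulloid (ρ : ℝ) (A : Set E3) : A ⊆ hulloid ρ A := fun a ha =>
  mem_hulloid_iff.2 fun _ hz => hz a ha

/-- A ball of radius `R` containing `x`, contracted towards `x` by `ρ / R`, stays inside itself. -/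
lemma hulloid_mono_radius {ρ R : ℝ} (hρ : 0 < ρ) (hR : ρ ≤ R) (A : Set E3) :
    hulloid ρ A ⊆ hulloid R A := by
  intro x hx
  rw [mem_hulloid_iff] at hx ⊢
  intro z hz
  by_contra! hlt
  have hR0 : 0 < R := hρ.trans_le hR
  have ht : ρ / R ≤ 1 := (div_le_one hR0).2 hR
  have ht0 : 0 < ρ / R := div_pos hρ hR0
  have htR : ρ / R * R = ρ := div_mul_cancel₀ _ hR0.ne'
  have h1 : dist x (AffineMap.lineMap x z (ρ / R)) = ρ / R * dist x z := by
    rw [dist_left_lineMap, Real.norm_of_nonneg ht0.le]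
  have h2 : dist (AffineMap.lineMap x z (ρ / R) : E3) z = (1 - ρ / R) * dist x z := by
    rw [dist_lineMap_right, Real.norm_of_nonneg (sub_nonneg.2 ht)]
  have h3 := hx (AffineMap.lineMap x z (ρ / R)) fun a ha => by
    have := dist_triangle a (AffineMap.lineMap x z (ρ / R) : E3) z
    have := hz a ha
    have : (1 - ρ / R) * dist x z ≤ (1 - ρ / R) * R :=
      mul_le_mul_of_nonneg_left hlt.le (sub_nonneg.2 ht)
    linarith
  have : ρ / R * dist x z < ρ / R * R := mul_lt_mul_of_pos_left hlt ht0
  linarith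

lemma hulloid_subset_of_convex {R : ℝ} (hR : 0 < R) {A K : Set E3} (hA : A.Nonempty)
    (hAK : A ⊆ K) (hK : Convex ℝ K) (hKc : IsClosed K) : hulloid R A ⊆ K := by
  intro x hx
  by_contra hxK
  obtain ⟨f, u, hfx, hfK⟩ := geometric_hahn_banach_point_closed hK hKc hxK
  obtain ⟨δ, hδ, hball⟩ := Metric.isOpen_iff.1 hKc.isOpen_compl x hxK
  obtain ⟨n, rfl⟩ := (InnerProductSpace.toDual ℝ E3).surjective f
  simp only [InnerProductSpace.toDual_apply_apply] at hfx hfK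
  have hn : n ≠ 0 := by
    rintro rfl
    obtain ⟨a, ha⟩ := hA
    have := hfK a (hAK ha)
    simp only [inner_zero_left] at hfx this
    linarith
  have hn' := norm_pos_iff.2 hn
  set ε := min δ R with hε
  have hε0 : 0 < ε := lt_min hδ hR
  have hεR : ε ^ 2 ≤ R ^ 2 := pow_le_pow_left₀ hε0.le (min_le_right _ _) 2
  -- The centre is moved from `x` away from `K` by `s < R`, so that the ball contains `x` but its
  -- part on the side of `K` lies within `ε` of `x`.
  set s := √(R ^ 2 - ε ^ 2) with hs
  have hs2 : s ^ 2 = R ^ 2 - ε ^ 2 := Real.sq_sqrt (sub_nonneg.2 hεR)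
  have hs0 : 0 ≤ s := Real.sqrt_nonneg _
  have hsn : ‖(s / ‖n‖) • n‖ = s := by
    rw [norm_smul, Real.norm_of_nonneg (by positivity), div_mul_cancel₀ _ hn'.ne']
  have key := mem_hulloid_iff.1 hx (x - (s / ‖n‖) • n) fun a ha => by
    have h1 : ε ≤ ‖a - x‖ := by
      refine (min_le_left _ _).trans ?_
      by_contra! hlt
      exact hball (by rwa [Metric.mem_ball, dist_eq_norm]) (hAK ha)
    have h2 : 0 ≤ ⟪a - x, (s / ‖n‖) • n⟫_ℝ := by
      rw [real_inner_smul_right, real_inner_comm, inner_sub_right]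
      have := hfK a (hAK ha)
      exact mul_nonneg (by positivity) (by linarith)
    rw [dist_eq_norm, sub_sub_eq_add_sub, add_sub_right_comm]
    refine le_of_sq_le_sq ?_ (norm_nonneg _)
    rw [norm_add_sq_real, hsn]
    have := pow_le_pow_left₀ hε0.le h1 2
    linarith
  rw [dist_eq_norm, sub_sub_cancel, hsn] at key
  have := pow_le_pow_left₀ hR.le key 2
  have := pow_pos hε0 2
  linarith

/-- A closed ball is strictly convex: only points of `A` in its hull can lie on the sphere. -/
lemma dist_lt_of_mem_convexHull {A : Set E3} {x z : E3} {R : ℝ} (hR : 0 < R)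
    (hA : ∀ a ∈ A, dist a z = R) (hx : x ∈ convexHull ℝ A) (hxA : x ∉ A) : dist x z < R := by
  have hsub : convexHull ℝ A ⊆ Metric.closedBall z R :=
    convexHull_min (fun a ha => (hA a ha).le) (convex_closedBall z R)
  refine lt_of_le_of_ne (hsub hx) fun heq => hxA ?_
  refine extremePoints_convexHull_subset (𝕜 := ℝ)
    (inter_extremePoints_subset_extremePoints_of_subset hsub ⟨hx, ?_⟩)
  exact StrictConvexSpace.sphere_subset_extremePoints_closedBall _ hR.ne' heq

/-! ### Four-crossing points and the hulloid of the vertex set -/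

namespace Tetrahedron

/-- The vertices of a tetrahedron as an affine basis of space. -/
noncomputable def basis (T : Tetrahedron) : AffineBasis (Fin 4) ℝ E3 :=
  ⟨T.points, T.independent,
    (T.independent.affineSpan_eq_top_iff_card_eq_finrank_add_one).2 (by simp)⟩

lemma coe_basis (T : Tetrahedron) : ⇑T.basis = T.points := rfl

lemma coord_pos_of_mem_interior {T : Tetrahedron} {O : E3} (hO : O ∈ interior T.solid)
    (i : Fin 4) : 0 < T.basis.coord i O := by
  have h : O ∈ interior (convexHull ℝ (Set.range T.basis)) := hO
  rw [AffineBasis.interior_convexHull] at h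
  exact h i

lemma coord_nonneg_of_mem_solid {T : Tetrahedron} {x : E3} (hx : x ∈ T.solid)
    (i : Fin 4) : 0 ≤ T.basis.coord i x := by
  have h : x ∈ convexHull ℝ (Set.range T.basis) := hx
  rw [AffineBasis.convexHull_eq_nonneg_coord] at h
  exact h i

lemma sum_coord_smul (T : Tetrahedron) (x : E3) : ∑ i, T.basis.coord i x • T.points i = x :=
  T.basis.linear_combination_coord_eq_self x

lemma notMem_vertices_of_mem_interior {T : Tetrahedron} {O : E3} (hO : O ∈ interior T.solid) :
    O ∉ T.vertices := by
  rintro ⟨i, rfl⟩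
  obtain ⟨j, hj⟩ := exists_ne i
  have h := coord_pos_of_mem_interior hO j
  rw [← T.coe_basis, T.basis.coord_apply_ne hj] at h
  exact h.false

/-- A point of the solid lies in the join of an interior point with one of the faces. -/
lemma exists_mem_convexHull_insert {T : Tetrahedron} {O x : E3} (hO : O ∈ interior T.solid)
    (hx : x ∈ T.solid) :
    ∃ j, x ∈ convexHull ℝ (insert O (T.points '' {i | i ≠ j})) := by
  set a := fun i => T.basis.coord i x with ha
  set w := fun i => T.basis.coord i O with hw
  have hw0 : ∀ i, 0 < w i := coord_pos_of_mem_interior hO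
  have ha1 : ∑ i, a i = 1 := T.basis.sum_coord_apply_eq_one x
  have hw1 : ∑ i, w i = 1 := T.basis.sum_coord_apply_eq_one O
  -- The least ratio is the largest multiple of `O` that can be subtracted from `x` keeping all
  -- coordinates nonnegative; the `j`-th then vanishes.
  obtain ⟨j, -, hj⟩ := Finset.exists_min_image Finset.univ (fun i => a i / w i)
    Finset.univ_nonempty
  refine ⟨j, ?_⟩
  set t := a j / w j with ht
  have ht0 : 0 ≤ t := div_nonneg (coord_nonneg_of_mem_solid hx j) (hw0 j).le
  have hθ : ∀ i, 0 ≤ a i - t * w i := fun i =>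
    sub_nonneg.2 ((le_div_iff₀ (hw0 i)).1 (hj i (Finset.mem_univ i)))
  have hθj : a j - t * w j = 0 := by
    rw [ht, div_mul_cancel₀ _ (hw0 j).ne', sub_self]
  have hθ1 : ∑ i, (a i - t * w i) = 1 - t := by
    rw [Finset.sum_sub_distrib, ← Finset.mul_sum, ha1, hw1, mul_one]
  have hxeq : x = t • O + ∑ i, (a i - t * w i) • (if i = j then O else T.points i) := by
    have h1 : ∀ i, (a i - t * w i) • (if i = j then O else T.points i)
        = a i • T.points i - t • (w i • T.points i) := fun i => by
      split_ifs with hij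
      · have : a j • T.points j = t • (w j • T.points j) := by
          rw [smul_smul, ← sub_eq_zero, ← sub_smul, hθj, zero_smul]
        rw [hij, hθj, zero_smul, this, sub_self]
      · rw [sub_smul, mul_smul]
    simp only [h1, Finset.sum_sub_distrib, ← Finset.smul_sum]
    rw [ha, hw, T.sum_coord_smul, T.sum_coord_smul]
    abel
  have hconv := convex_convexHull ℝ (insert O (T.points '' {i | i ≠ j}))
  have := hconv.sum_mem (t := (Finset.univ : Finset (Option (Fin 4))))
    (w := fun o => o.elim t fun i => a i - t * w i)
    (z := fun o => o.elim O fun i => if i = j then O else T.points i)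
    (by rintro (_ | i) -; exacts [ht0, hθ i])
    (by rw [Fintype.sum_option]; simp only [Option.elim]; rw [hθ1]; ring)
    (by
      rintro (_ | i) -
      · exact subset_convexHull ℝ _ (Set.mem_insert _ _)
      · refine subset_convexHull ℝ _ ?_
        simp only [Option.elim]
        split_ifs with hij
        · exact Set.mem_insert _ _
        · exact Set.mem_insert_of_mem _ ⟨i, hij, rfl⟩)
  rw [Fintype.sum_option] at this
  rw [hxeq]
  exact this

lemma IsFourCrossing.exists_crossingData {T : Tetrahedron} {R : ℝ} {O : E3}
    (h : T.IsFourCrossing R O) (hO : O ∈ interior T.solid) :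
    ∃ p : Fin 4 → E3, CrossingData (fun i => T.points i - O) (fun j => p j - O)
      (fun i => T.basis.coord i O) R := by
  obtain ⟨-, S, -, hrad, hmem, hinter, -⟩ := h
  have hOS : ∀ j, O ∈ S j := by
    have : O ∈ ⋂ j, {x : E3 | x ∈ S j} := by rw [hinter]; rfl
    exact fun j => Set.mem_iInter.1 this j
  have hsum : ∑ i, T.basis.coord i O = 1 := T.basis.sum_coord_apply_eq_one O
  have hsmul : ∑ i, T.basis.coord i O • (T.points i - O) = 0 := by
    simp only [smul_sub, Finset.sum_sub_distrib, T.sum_coord_smul, ← Finset.sum_smul, hsum,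
      one_smul, sub_self]
  refine ⟨fun j => (S j).center, coord_pos_of_mem_interior hO, hsum, hsmul, fun i hi => ?_,
    fun y hy => ?_, fun j => ?_, fun i j hij => ?_⟩
  · exact notMem_vertices_of_mem_interior hO ⟨i, sub_eq_zero.1 hi⟩
  · have h1 : y = ∑ i, T.basis.coord i (y + O) • (T.points i - O) := by
      simp only [smul_sub, Finset.sum_sub_distrib, T.sum_coord_smul, ← Finset.sum_smul,
        T.basis.sum_coord_apply_eq_one, one_smul, add_sub_cancel_right]
    have h2 : ⟪y, y⟫_ℝ = 0 := by
      conv_lhs => enter [2]; rw [h1]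
      simp only [sum_inner, real_inner_smul_left, hy, mul_zero, Finset.sum_const_zero]
    exact inner_self_eq_zero.1 h2
  · rw [← dist_eq_norm, dist_comm, ← hrad j]; exact hOS j
  · rw [sub_sub_sub_cancel_right, ← dist_eq_norm, ← hrad j]; exact hmem j i hij

lemma IsFourCrossing.hulloid_eq {T : Tetrahedron} {R : ℝ} {O : E3}
    (h : T.IsFourCrossing R O) (hO : O ∈ interior T.solid) :
    hulloid R T.vertices = T.vertices ∪ {O} := by
  have hR := h.1
  obtain ⟨p, hp⟩ := h.exists_crossingData hO
  refine Set.Subset.antisymm (fun x hx => ?_) (Set.union_subset (subset_hulloid _ _) ?_)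
  · have hxT : x ∈ T.solid := hulloid_subset_of_convex hR (Set.range_nonempty _)
      (subset_convexHull ℝ _) (convex_convexHull ℝ _)
      ((Set.finite_range T.points).isClosed_convexHull ℝ) hx
    by_contra hxn
    rw [Set.mem_union, not_or, Set.mem_singleton_iff] at hxn
    -- `O` and the face opposite vertex `j` have all their vertices on the `j`-th sphere, so `x` is
    -- inside a ball avoiding `V`.
    obtain ⟨j, hj⟩ := exists_mem_convexHull_insert hO hxT
    refine (mem_hulloid_iff.1 hx (p j) ?_).not_gt (dist_lt_of_mem_convexHull hR ?_ hj ?_)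
    · rintro _ ⟨i, rfl⟩
      have := hp.le_norm_sub_vertex i j
      rwa [sub_sub_sub_cancel_right, ← dist_eq_norm] at this
    · rintro a (rfl | ⟨i, hi, rfl⟩)
      · rw [dist_comm, dist_eq_norm]; exact hp.norm_center j
      · have := hp.norm_sub i j hi
        rwa [sub_sub_sub_cancel_right, ← dist_eq_norm] at this
    · rintro (hxO | ⟨i, -, hi⟩)
      · exact hxn.2 hxO
      · exact hxn.1 ⟨i, hi⟩
  · rw [Set.singleton_subset_iff, mem_hulloid_iff]
    intro z hz
    by_contra! hlt
    rw [dist_comm, dist_eq_norm] at hlt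
    refine hlt.ne (hp.eq_of_avoids hR le_rfl hlt.le fun i => ?_).2
    rw [sub_sub_sub_cancel_right, ← dist_eq_norm]
    exact hz _ ⟨i, rfl⟩

lemma IsFourCrossing.interior_hulloid_nonempty {T : Tetrahedron} {R ρ : ℝ} {O : E3}
    (h : T.IsFourCrossing R O) (hO : O ∈ interior T.solid) (hρ : R < ρ) :
    (interior (hulloid ρ T.vertices)).Nonempty := by
  obtain ⟨p, hp⟩ := h.exists_crossingData hO
  set Z : Set E3 := {z | ∀ i, ρ ≤ dist (T.points i) z} with hZ
  have hZc : IsClosed Z := by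
    rw [hZ, Set.ofPred_forall]
    exact isClosed_iInter fun i => isClosed_le continuous_const (by fun_prop)
  have hfar : ∀ z ∈ Z, ρ < dist O z := fun z hz => by
    by_contra! hle
    rw [dist_comm, dist_eq_norm] at hle
    refine hρ.ne' (hp.eq_of_avoids h.1 hρ.le hle fun i => ?_).1
    rw [sub_sub_sub_cancel_right, ← dist_eq_norm]
    exact hz i
  -- The distance from `O` to the closed set `Z` is attained, which makes the strict bound `hfar`
  -- uniform.
  obtain ⟨ε, hε, hgap⟩ : ∃ ε > 0, ∀ z ∈ Z, ρ + ε ≤ dist O z := by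
    rcases Z.eq_empty_or_nonempty with hem | hne
    · exact ⟨1, one_pos, fun z hz => by simp [hem] at hz⟩
    · obtain ⟨z₀, hz₀, hmin⟩ := hZc.exists_infDist_eq_dist hne O
      refine ⟨dist O z₀ - ρ, sub_pos.2 (hfar z₀ hz₀), fun z hz => ?_⟩
      rw [add_sub_cancel, ← hmin]
      exact Metric.infDist_le_dist_of_mem hz
  refine ⟨O, mem_interior.2 ⟨Metric.ball O ε, fun x hx => ?_, Metric.isOpen_ball,
    Metric.mem_ball_self hε⟩⟩
  refine mem_hulloid_iff.2 fun z hz => ?_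
  have h1 := hgap z fun i => hz _ ⟨i, rfl⟩
  have h2 := dist_triangle O x z
  rw [Metric.mem_ball'] at hx
  linarith

lemma IsFourCrossing.circumradius_lt {T : Tetrahedron} {R : ℝ} {O : E3}
    (h : T.IsFourCrossing R O) (hO : O ∈ interior T.solid) : T.circumradius < R := by
  obtain ⟨p, hp⟩ := h.exists_crossingData hO
  refine hp.circumradius_lt (q := T.circumcenter - O) h.1 T.circumradius_pos fun i => ?_
  rw [sub_sub_sub_cancel_right, ← dist_eq_norm]
  exact T.dist_circumcenter_eq_circumradius i

lemma IsFourCrossing.rL_eq {T : Tetrahedron} {R : ℝ} {O : E3}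
    (h : T.IsFourCrossing R O) (hO : O ∈ interior T.solid) : T.rL = R := by
  have hrR := h.circumradius_lt hO
  have hmem : ∀ ρ, R < ρ → ρ ∈ {ρ : ℝ | T.circumradius < ρ ∧
      (interior (hulloid ρ T.vertices)).Nonempty} := fun ρ hρ =>
    ⟨hrR.trans hρ, h.interior_hulloid_nonempty hO hρ⟩
  refine csInf_eq_of_forall_ge_of_forall_gt_exists_lt ⟨R + 1, hmem _ (lt_add_one R)⟩ ?_ ?_
  · rintro ρ ⟨hρ, hne⟩
    by_contra! hlt
    have hsub := hulloid_mono_radius (T.circumradius_pos.trans hρ) hlt.le T.vertices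
    rw [h.hulloid_eq hO] at hsub
    have hfin : (T.vertices ∪ {O}).Finite :=
      (Set.finite_range T.points).union (Set.finite_singleton O)
    have := hne.mono (interior_mono hsub)
    rw [hfin.countable.dense_compl ℝ |> interior_eq_empty_iff_dense_compl.2] at this
    exact Set.not_nonempty_empty this
  · intro u hu
    obtain ⟨ρ, h1, h2⟩ := exists_between hu
    exact ⟨ρ, hmem ρ h1, h2⟩

end Tetrahedron

lemma eq_of_union_singleton_eq {α : Type*} {A : Set α} {p q : α} (hp : p ∉ A)
    (h : A ∪ {q} = A ∪ {p}) : p = q := by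
  have : p ∈ A ∪ {q} := h ▸ Or.inr rfl
  exact this.resolve_left hp

theorem theorem4p3 (T : Tetrahedron) (R : ℝ) (O : E3)
    (hRO : T.IsFourCrossing R O) (hO : O ∈ interior T.solid) :
    -- `R` and `O` are uniquely determined
    (∀ (R' : ℝ) (O' : E3), T.IsFourCrossing R' O' → O' ∈ interior T.solid →
      R' = R ∧ O' = O) ∧
    -- `R = r_L(V) > r(V)`
    T.circumradius < T.rL ∧ R = T.rL ∧
    -- `O` is the point `O*` with `co_{r_L(V)}(V) = V ∪ {O*}`, the only one outside `V`
    hulloid T.rL T.vertices = T.vertices ∪ {O} ∧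
    (∀ p : E3, p ∉ T.vertices → hulloid T.rL T.vertices = T.vertices ∪ {p} → p = O) := by
  have hrL := hRO.rL_eq hO
  have hhull := hRO.hulloid_eq hO
  rw [hrL]
  refine ⟨fun R' O' h' hO' => ?_, hRO.circumradius_lt hO, rfl, hhull, fun p hp hph => ?_⟩
  · obtain rfl : R' = R := (h'.rL_eq hO').symm.trans hrL
    exact ⟨rfl, eq_of_union_singleton_eq (Tetrahedron.notMem_vertices_of_mem_interior hO')
      (hhull.symm.trans (h'.hulloid_eq hO'))⟩
  · exact eq_of_union_singleton_eq hp (hhull.symm.trans hph)
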